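/- For integers $0\le d\le n-1$ put $\omega_d=\frac{d+1}{n-d}$. For a $d$-dimensional rational affine subspace $L\subset\mathbb R^n$ (the affine span of its points in $\mathbb Q^n$), let $V_L\subset\mathbb R^{n+1}$ be the $(d+1)$-dimensional linear subspace spanned by the vectors $(\mathbf y,1)$ with $\mathbf y\in L$, let the height $H(L)$ be the $(d+1)$-dimensional Euclidean volume (covolume in $V_L$) of the lattice $\mathbb Z^{n+1}\cap V_L$, and let $d(\mathbf x,L)=\min_{\mathbf y\in L}\max_{1\le i\le n}|x_i-y_i|$. On $\bigwedge^k\mathbb R^n$ let $\|\cdot\|$ be the maximum norm with respect to the basis $\mathbf e_{i_1}\wedge\dots\wedge \mathbf e_{i_k}$ $(i_1<\dots<i_k)$, and let $\bigwedge^k\mathbb Z^n$ be the lattice generated by this basis. Let $n\in\mathbb N$ and $\mathbf x\in\mathbb R^n$. Consider the following two statements. (A) For every integer $d$ with $0\le d\le n-1$ and every real $N>1$ there are $\mathbf Z\in\bigwedge^d\mathbb Z^n\setminus\{0\}$ and $\mathbf Y\in\bigwedge^{d+1}\mathbb Z^n$ such that $$\|\mathbf Z\|\le N\quad\text{and}\quad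 \|\mathbf x\wedge\mathbf Z+\mathbf Y\|\le N^{-\omega_d}.$$ (B) There is a constant $c=c(\mathbf x,n)>0$ such that for every integer $d$ with $0\le d\le n-1$ and every integer $N\ge1$ there is a $d$-dimensional rational affine subspace $L\subset\mathbb R^n$ such that $$d(\mathbf x,L)\le c\,H(L)^{-1}N^{-\omega_d}\quad\text{and}\quad H(L)\le N.$$ Then (A) holds, and (A) implies (B). -/

import Mathlib

noncomputable section

namespace RationalApprox

/-- The exponent `ω_d = (d + 1) / (n - d)`. -/
def omega (n d : ℕ) : ℝ := ((d : ℝ) + 1) / ((n : ℝ) - (d : ℝ))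

/-! ### Rational affine subspaces of `ℝⁿ` -/

/-- The embedding `y ↦ (y₁, …, yₙ, 1)` of `ℝⁿ` into Euclidean `ℝⁿ⁺¹`. -/
def homogenize {n : ℕ} (y : Fin n → ℝ) : EuclideanSpace ℝ (Fin (n + 1)) :=
  WithLp.toLp 2 (Fin.snoc (α := fun _ => ℝ) y 1)

/-- The linear subspace of `ℝⁿ⁺¹` spanned by the points `(y, 1)` with `y ∈ L`. If `L` is a
`d`-dimensional affine subspace, this is the unique `(d + 1)`-dimensional linear subspace
containing all these points. -/
def coneSpan {n : ℕ} (L : AffineSubspace ℝ (Fin n → ℝ)) :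
    Submodule ℝ (EuclideanSpace ℝ (Fin (n + 1))) :=
  Submodule.span ℝ (homogenize '' (L : Set (Fin n → ℝ)))

/-- The lattice `ℤᵐ` in Euclidean `ℝᵐ`. -/
def integerLattice (m : ℕ) : Submodule ℤ (EuclideanSpace ℝ (Fin m)) :=
  Submodule.span ℤ (Set.range (EuclideanSpace.basisFun (Fin m) ℝ))

/-- The `k`-dimensional volume on a `k`-dimensional linear subspace `V` of Euclidean space: the
translation invariant measure for which the unit cube of an orthonormal basis of `V` has
measure `1`. -/
def subspaceVolume {m : ℕ} (V : Submodule ℝ (EuclideanSpace ℝ (Fin m))) :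
    MeasureTheory.Measure V :=
  (stdOrthonormalBasis ℝ V).toBasis.addHaar

/-- The height of an affine subspace `L` of `ℝⁿ`: the covolume of the lattice `ℤⁿ⁺¹ ∩ V` in `V`,
where `V = coneSpan L`. -/
def height {n : ℕ} (L : AffineSubspace ℝ (Fin n → ℝ)) : ℝ :=
  ZLattice.covolume (ZLattice.comap ℝ (integerLattice (n + 1)) (coneSpan L).subtype)
    (subspaceVolume (coneSpan L))

/-- `L` is a `d`-dimensional rational affine subspace of `ℝⁿ`: it is nonempty, its direction has
dimension `d`, and it is the affine span of the points of `ℚⁿ` that lie on it. -/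
structure IsRationalSubspace {n : ℕ} (d : ℕ) (L : AffineSubspace ℝ (Fin n → ℝ)) : Prop where
  nonempty : (L : Set (Fin n → ℝ)).Nonempty
  finrank_direction : Module.finrank ℝ L.direction = d
  affineSpan_rational :
    affineSpan ℝ {y : Fin n → ℝ | y ∈ L ∧ ∃ r : Fin n → ℚ, ∀ i, y i = (r i : ℝ)} = L

/-! ### Exterior powers of `ℝⁿ` -/

/-- The standard basis `e_{i₁} ∧ ⋯ ∧ e_{i_k}`, `i₁ < ⋯ < i_k`, of `⋀ᵏ ℝⁿ`. -/
def wedgeBasis (n k : ℕ) :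
    Module.Basis (Set.powersetCard (Fin n) k) ℝ (⋀[ℝ]^k (Fin n → ℝ)) :=
  (Pi.basisFun ℝ (Fin n)).exteriorPower k

/-- The lattice `⋀ᵏ ℤⁿ` in `⋀ᵏ ℝⁿ`. -/
def integerWedge (n k : ℕ) : Submodule ℤ (⋀[ℝ]^k (Fin n → ℝ)) :=
  Submodule.span ℤ (Set.range (wedgeBasis n k))

/-- The maximum norm on `⋀ᵏ ℝⁿ` with respect to the standard basis. -/
def wedgeMaxNorm {n k : ℕ} (X : ⋀[ℝ]^k (Fin n → ℝ)) : ℝ :=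
  ‖(wedgeBasis n k).equivFun X‖

/-- The wedge product `x ∧ Z ∈ ⋀ᵏ⁺¹ ℝⁿ` of a vector `x ∈ ℝⁿ` and `Z ∈ ⋀ᵏ ℝⁿ`. -/
def wedge {n k : ℕ} (x : Fin n → ℝ) (Z : ⋀[ℝ]^k (Fin n → ℝ)) : ⋀[ℝ]^(k + 1) (Fin n → ℝ) :=
  ⟨ExteriorAlgebra.ι ℝ x * (Z : ExteriorAlgebra ℝ (Fin n → ℝ)), by
    rw [ExteriorAlgebra.exteriorPower, pow_succ']
    exact Submodule.mul_mem_mul (LinearMap.mem_range_self _ x) Z.2⟩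

/-- The exterior algebra form of Dirichlet's theorem at the point `x ∈ ℝⁿ`, in degree `d`: for
every real `N > 1` there are `Z ∈ ⋀ᵈ ℤⁿ ∖ {0}` and `Y ∈ ⋀ᵈ⁺¹ ℤⁿ` with `‖Z‖ ≤ N` and
`‖x ∧ Z + Y‖ ≤ N ^ (-ω_d)`. -/
def ExteriorDirichlet {n : ℕ} (d : ℕ) (x : Fin n → ℝ) : Prop :=
  ∀ N : ℝ, 1 < N →
    ∃ Z ∈ integerWedge n d, Z ≠ 0 ∧ ∃ Y ∈ integerWedge n (d + 1),
      wedgeMaxNorm Z ≤ N ∧ wedgeMaxNorm (wedge x Z + Y) ≤ N ^ (-omega n d)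

end RationalApprox

end

/-! Statement (A) is Minkowski's linear forms theorem for the coordinates of `Z` and of `x ∧ Z + Y`:
since `ω_d * n.choose (d + 1) = n.choose d`, the box `‖Z‖ ≤ N`, `‖x ∧ Z + Y‖ ≤ N ^ (-ω_d)` has
exactly the critical volume.

The conclusion of (B) is obtained from Minkowski's second theorem in `ℝⁿ⁺¹`. With `A * B ^ n = 1`,
the map `shear x A B` has determinant 1, and being short under it means having last coordinate at
most `A` and lying within `B` of the line through `(x, 1)`. Vectors realising the successive minima
have a bounded product of sheared lengths `r i`; so do the first `d + 1` of them. These span the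
cone over the desired `L`.

To bound the height, let `v 0` maximise |last coordinate| / `r i` and subtract multiples of it to
clear the other last coordinates. Hadamard's inequality then gives `height L ≪ |q| * B ^ d * ∏ r j`
over `j ≠ 0`, with `q` the last coordinate of `v 0`. The rational point `v 0 / q` of `L` is within
`r 0 * B / |q|` of `x`, so `q` cancels in distance times height, leaving `≪ B ^ (d + 1)`, while
`height L ≪ A * B ^ d`. It remains to choose `A` and `B` in terms of `N`. -/

noncomputable section
namespace RationalApprox

/-! ### Linear forms and statement (A) -/

/-- Minkowski's linear forms theorem for `q ↦ q` and `(q, p) ↦ A q + p`. -/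
theorem exists_int_linearForms_le {ι κ : Type*} [Fintype ι] [Fintype κ] [Nonempty κ]
    (A : (ι → ℝ) →ₗ[ℝ] (κ → ℝ)) {N ε : ℝ} (hN : 0 < N) (hε : 0 < ε)
    (h : 1 ≤ N ^ Fintype.card ι * ε ^ Fintype.card κ) :
    ∃ (q : ι → ℤ) (p : κ → ℤ), (q ≠ 0 ∨ p ≠ 0) ∧ (∀ i, |(q i : ℝ)| ≤ N) ∧
      ∀ k, |A (fun i => (q i : ℝ)) k + p k| ≤ ε := by
  classical
  -- `M` inverts `(q, p) ↦ (q, A q + p)`, so the image of the box under `M` is the set of admissible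
  -- `(q, p)`, with the same volume. The box is closed, hence compact, so the non-strict volume
  -- condition suffices.
  let M : Matrix (ι ⊕ κ) (ι ⊕ κ) ℝ := Matrix.fromBlocks 1 0 (-LinearMap.toMatrix' A) 1
  have hdet : LinearMap.det (Matrix.toLin' M) = 1 := by
    rw [LinearMap.det_toLin', Matrix.det_fromBlocks_zero₁₂]
    simp
  let r : ι ⊕ κ → ℝ := Sum.elim (fun _ => N) (fun _ => ε)
  let K : Set (ι ⊕ κ → ℝ) := Set.pi Set.univ fun i => Set.Icc (-r i) (r i)
  have hr : ∀ i, 0 < r i := by rintro (i | i) <;> simpa [r]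
  have hKvol : MeasureTheory.volume K = ENNReal.ofReal (∏ i, (2 * r i)) := by
    rw [MeasureTheory.volume_pi, MeasureTheory.Measure.pi_pi,
      ENNReal.ofReal_prod_of_nonneg fun i _ => by have := hr i; positivity]
    simp only [Real.volume_Icc]
    congr! 2
    ring
  have hKconv : Convex ℝ K := convex_pi fun i _ => convex_Icc _ _
  have hKcpt : IsCompact K := isCompact_univ_pi fun i => isCompact_Icc
  let s := Matrix.toLin' M '' K
  have hvol : MeasureTheory.volume (ZSpan.fundamentalDomain (Pi.basisFun ℝ (ι ⊕ κ))) *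
      2 ^ Module.finrank ℝ (ι ⊕ κ → ℝ) ≤ MeasureTheory.volume s := by
    rw [MeasureTheory.Measure.addHaar_image_linearMap, hdet, hKvol, ZSpan.volume_fundamentalDomain]
    have h1 : (Matrix.of (Pi.basisFun ℝ (ι ⊕ κ))).det = 1 := by
      rw [← Pi.basisFun_det_apply]; exact Module.Basis.det_self _
    rw [h1, Module.finrank_fintype_fun_eq_card, Finset.prod_mul_distrib]
    simp only [abs_one, ENNReal.ofReal_one, one_mul, Finset.prod_const, Finset.card_univ]
    rw [ENNReal.ofReal_mul (by positivity), ENNReal.ofReal_pow (by norm_num)]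
    have h2 : (1 : ENNReal) ≤ ENNReal.ofReal (∏ i, r i) := by
      rw [ENNReal.one_le_ofReal]
      simpa [Fintype.prod_sum_type, r] using h
    calc (2 : ENNReal) ^ Fintype.card (ι ⊕ κ) = 2 ^ Fintype.card (ι ⊕ κ) * 1 := by simp
      _ ≤ _ := by
        gcongr
        simp
  have hsymm : ∀ x ∈ s, -x ∈ s := by
    rintro _ ⟨y, hy, rfl⟩
    refine ⟨-y, fun i hi => ?_, map_neg _ _⟩
    have := hy i hi
    simp only [Set.mem_Icc, Pi.neg_apply] at this ⊢
    constructor <;> linarith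
  have : Countable (Submodule.span ℤ (Set.range (Pi.basisFun ℝ (ι ⊕ κ)))).toAddSubgroup :=
    inferInstanceAs (Countable (Submodule.span ℤ (Set.range (Pi.basisFun ℝ (ι ⊕ κ)))))
  obtain ⟨⟨y, hy⟩, hy0, z, hz, hzy⟩ :=
    MeasureTheory.exists_ne_zero_mem_lattice_of_measure_mul_two_pow_le_measure
      (ZSpan.isAddFundamentalDomain' (Pi.basisFun ℝ (ι ⊕ κ)) MeasureTheory.volume) hsymm
      (hKconv.linear_image _)
      (hKcpt.image (LinearMap.continuous_of_finiteDimensional _)) hvol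
  have hyint : ∀ i, ∃ a : ℤ, (a : ℝ) = y i := by
    have := (Module.Basis.mem_span_iff_repr_mem ℤ (Pi.basisFun ℝ (ι ⊕ κ)) y).1 hy
    intro i
    obtain ⟨a, ha⟩ := this i
    exact ⟨a, by simpa using ha⟩
  choose a ha using hyint
  have hfst : ∀ i, y (Sum.inl i) = z (Sum.inl i) := by
    intro i
    simp only at hzy
    rw [← hzy, Matrix.toLin'_apply, ← Sum.elim_comp_inl_inr z]
    simp [M, Matrix.fromBlocks_mulVec]
  have hsnd : ∀ k, y (Sum.inr k) = -A (fun i => z (Sum.inl i)) k + z (Sum.inr k) := by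
    intro k
    simp only at hzy
    rw [← hzy, Matrix.toLin'_apply, ← Sum.elim_comp_inl_inr z]
    simp [M, Matrix.fromBlocks_mulVec, Matrix.neg_mulVec, LinearMap.toMatrix'_mulVec,
      Function.comp_def]
  refine ⟨fun i => a (Sum.inl i), fun k => a (Sum.inr k), ?_, fun i => ?_, fun k => ?_⟩
  · by_contra! hcon
    apply hy0
    ext i
    rcases i with i | i
    · simpa [← ha] using congrFun hcon.1 i
    · simpa [← ha] using congrFun hcon.2 i
  · rw [ha, hfst]
    exact abs_le.2 (hz (Sum.inl i) trivial)
  · have : (fun i => ((a (Sum.inl i) : ℤ) : ℝ)) = fun i => z (Sum.inl i) := by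
      ext i; rw [ha, hfst]
    rw [this, ha, hsnd]
    have h1 : |z (Sum.inr k)| ≤ ε := abs_le.2 (hz (Sum.inr k) trivial)
    simpa using h1

/-- `Z ↦ x ∧ Z` as a linear map. -/
def wedgeLinear {n : ℕ} (k : ℕ) (x : Fin n → ℝ) :
    (⋀[ℝ]^k (Fin n → ℝ)) →ₗ[ℝ] ⋀[ℝ]^(k + 1) (Fin n → ℝ) where
  toFun := wedge x
  map_add' _ _ := Subtype.ext (mul_add _ _ _)
  map_smul' _ _ := Subtype.ext (mul_smul_comm _ _ _)

theorem card_powersetCard_fin (n k : ℕ) :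
    Fintype.card (Set.powersetCard (Fin n) k) = n.choose k := by
  rw [← Nat.card_eq_fintype_card, Set.powersetCard.card, Nat.card_eq_fintype_card,
    Fintype.card_fin]

theorem omega_pos {n d : ℕ} (hd : d < n) : 0 < omega n d := by
  have : (d : ℝ) < n := by exact_mod_cast hd
  exact div_pos (by positivity) (by linarith)

/-- This balance between the numbers of coordinates in degrees `d` and `d + 1` is what singles out
the exponent `ω_d`. -/
theorem omega_mul_choose {n d : ℕ} (hd : d < n) :
    omega n d * n.choose (d + 1) = n.choose d := by
  have h1 : (d : ℝ) < n := by exact_mod_cast hd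
  have h2 := Nat.choose_succ_right_eq n d
  have h3 : (n.choose (d + 1) : ℝ) * (d + 1) = n.choose d * (n - d) := by
    rw [← Nat.cast_sub hd.le]; exact_mod_cast h2
  rw [omega, div_mul_eq_mul_div, div_eq_iff (by linarith)]
  linarith

theorem equivFun_symm_mem_integerWedge {n k : ℕ} (a : Set.powersetCard (Fin n) k → ℤ) :
    (wedgeBasis n k).equivFun.symm (fun i => (a i : ℝ)) ∈ integerWedge n k := by
  rw [Module.Basis.equivFun_symm_apply]
  refine Submodule.sum_mem _ fun i _ => ?_
  rw [Int.cast_smul_eq_zsmul]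
  exact Submodule.smul_mem _ _ (Submodule.subset_span ⟨i, rfl⟩)

theorem exteriorDirichlet {n d : ℕ} (hd : d < n) (x : Fin n → ℝ) : ExteriorDirichlet d x := by
  intro N hN
  have hN0 : 0 < N := by linarith
  have hε : 0 < N ^ (-omega n d) := Real.rpow_pos_of_pos hN0 _
  have hε1 : N ^ (-omega n d) < 1 :=
    Real.rpow_lt_one_of_one_lt_of_neg hN (neg_neg_of_pos (omega_pos hd))
  let A : (Set.powersetCard (Fin n) d → ℝ) →ₗ[ℝ] (Set.powersetCard (Fin n) (d + 1) → ℝ) :=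
    (wedgeBasis n (d + 1)).equivFun.toLinearMap ∘ₗ wedgeLinear d x ∘ₗ
      (wedgeBasis n d).equivFun.symm.toLinearMap
  have : Nonempty (Set.powersetCard (Fin n) (d + 1)) := by
    rw [← Fintype.card_pos_iff, card_powersetCard_fin]
    exact Nat.choose_pos hd
  obtain ⟨q, p, hqp, hq, hp⟩ := exists_int_linearForms_le A hN0 hε (by
    rw [card_powersetCard_fin, card_powersetCard_fin, ← Real.rpow_natCast,
      ← Real.rpow_natCast, ← Real.rpow_mul hN0.le, ← Real.rpow_add hN0, neg_mul,
      omega_mul_choose hd]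
    simp)
  refine ⟨_, equivFun_symm_mem_integerWedge q, ?_, _, equivFun_symm_mem_integerWedge p, ?_, ?_⟩
  -- If `Z = 0`, then `‖Y‖ ≤ N ^ (-ω_d) < 1` forces `Y = 0` by integrality, so the whole lattice
  -- point would vanish.
  · intro h0
    rw [LinearEquiv.map_eq_zero_iff] at h0
    have hq0 : q = 0 := by
      ext i; simpa using congrFun h0 i
    refine hqp.elim (fun h => h hq0) fun h => h ?_
    ext k
    have := (hp k).trans_lt hε1
    rw [h0, map_zero, Pi.zero_apply, zero_add] at this
    exact Int.abs_lt_one_iff.1 (by exact_mod_cast this)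
  · rw [wedgeMaxNorm, LinearEquiv.apply_symm_apply]
    exact (pi_norm_le_iff_of_nonneg hN0.le).2 hq
  · rw [wedgeMaxNorm, map_add, LinearEquiv.apply_symm_apply]
    exact (pi_norm_le_iff_of_nonneg hε.le).2 hp

/-! ### Successive minima and Minkowski's second theorem -/

theorem integerLattice_eq_span (m : ℕ) : integerLattice m =
    Submodule.span ℤ (Set.range (EuclideanSpace.basisFun (Fin m) ℝ).toBasis) := by
  rw [OrthonormalBasis.coe_toBasis]; rfl

theorem span_integerLattice (m : ℕ) :
    Submodule.span ℝ (integerLattice m : Set (EuclideanSpace ℝ (Fin m))) = ⊤ := by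
  rw [integerLattice_eq_span, Submodule.span_span_of_tower, Module.Basis.span_eq]

theorem mem_integerLattice_iff {m : ℕ} {v : EuclideanSpace ℝ (Fin m)} :
    v ∈ integerLattice m ↔ ∀ i, ∃ a : ℤ, (a : ℝ) = v i := by
  rw [integerLattice_eq_span, Module.Basis.mem_span_iff_repr_mem]
  simp

instance discreteTopology_integerLattice (m : ℕ) : DiscreteTopology (integerLattice m) := by
  rw [integerLattice_eq_span]; infer_instance

/-- Some integer vector `u` lies outside `W`, and only finitely many integer vectors satisfy `‖g v‖
≤ ‖g u‖`, so the minimum is attained. -/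
theorem exists_minimal_notMem {m : ℕ}
    (g : EuclideanSpace ℝ (Fin m) ≃ₗ[ℝ] EuclideanSpace ℝ (Fin m))
    {W : Submodule ℝ (EuclideanSpace ℝ (Fin m))} (hW : W ≠ ⊤) :
    ∃ v ∈ integerLattice m, v ∉ W ∧ ∀ x ∈ integerLattice m, x ∉ W → ‖g v‖ ≤ ‖g x‖ := by
  obtain ⟨u, hu, huW⟩ : ∃ u ∈ integerLattice m, u ∉ W := by
    by_contra! h
    exact hW (top_le_iff.1 (span_integerLattice m ▸ Submodule.span_le.2 h))
  have hbdd : Bornology.IsBounded {v | ‖g v‖ ≤ ‖g u‖} := by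
    have : {v | ‖g v‖ ≤ ‖g u‖} = g.symm '' Metric.closedBall 0 ‖g u‖ := by
      rw [LinearEquiv.image_eq_preimage_symm]
      ext v; simp
    rw [this]
    exact ((isCompact_closedBall _ _).image
      (LinearMap.continuous_of_finiteDimensional g.symm.toLinearMap)).isBounded
  have hfin : ({v | ‖g v‖ ≤ ‖g u‖} ∩ integerLattice m : Set _).Finite := by
    rw [integerLattice_eq_span]
    exact ZSpan.setFinite_inter _ hbdd
  obtain ⟨v, ⟨⟨hvu, hv⟩, hvW⟩, hmin⟩ := Set.exists_min_image _ (fun v => ‖g v‖)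
    (hfin.inter_of_left {v | v ∉ W}) ⟨u, ⟨le_refl ‖g u‖, hu⟩, huW⟩
  refine ⟨v, hv, hvW, fun x hx hxW => ?_⟩
  by_cases h : ‖g x‖ ≤ ‖g u‖
  · exact hmin x ⟨⟨h, hx⟩, hxW⟩
  · exact hvu.trans (not_le.1 h).le

/-- Integer vectors realising the successive minima of `v ↦ ‖g v‖`. -/
theorem exists_successive_minima {m : ℕ}
    (g : EuclideanSpace ℝ (Fin m) ≃ₗ[ℝ] EuclideanSpace ℝ (Fin m)) :
    ∃ v : Fin m → EuclideanSpace ℝ (Fin m), (∀ i, v i ∈ integerLattice m) ∧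
      LinearIndependent ℝ v ∧
      ∀ i, ∀ x ∈ integerLattice m, x ∉ Submodule.span ℝ (v '' Set.Iio i) → ‖g (v i)‖ ≤ ‖g x‖ := by
  have hpick : ∀ W : Submodule ℝ (EuclideanSpace ℝ (Fin m)), ∃ v ∈ integerLattice m,
      W ≠ ⊤ → v ∉ W ∧ ∀ x ∈ integerLattice m, x ∉ W → ‖g v‖ ≤ ‖g x‖ := by
    intro W
    by_cases hW : W = ⊤
    · exact ⟨0, zero_mem _, fun h => absurd hW h⟩
    · obtain ⟨v, h1, h2⟩ := exists_minimal_notMem g hW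
      exact ⟨v, h1, fun _ => h2⟩
  choose pick hpickmem hpick using hpick
  obtain ⟨W, hW0, hWsucc⟩ : ∃ W : ℕ → Submodule ℝ (EuclideanSpace ℝ (Fin m)),
      W 0 = ⊥ ∧ ∀ k, W (k + 1) = W k ⊔ Submodule.span ℝ {pick (W k)} :=
    ⟨fun k => Nat.rec ⊥ (fun _ V => V ⊔ Submodule.span ℝ {pick V}) k, rfl, fun _ => rfl⟩
  have hWspan : ∀ k, W k = Submodule.span ℝ ((fun j => pick (W j)) '' Set.Iio k) := by
    intro k
    induction k with
    | zero => simp [hW0]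
    | succ k ih =>
      have hI : Set.Iio (k + 1) = insert k (Set.Iio k) := by
        ext j; simp only [Set.mem_Iio, Set.mem_insert_iff]; omega
      rw [hWsucc, hI, Set.image_insert_eq, Submodule.span_insert, sup_comm, ← ih]
  have hWle : ∀ k : ℕ, Module.finrank ℝ ↥(W k) ≤ k := by
    intro k
    have h1 : (fun j => pick (W j)) '' Set.Iio k = Set.range (fun j : Fin k => pick (W j)) := by
      ext u
      constructor
      · rintro ⟨j, hj, rfl⟩
        exact ⟨⟨j, hj⟩, rfl⟩
      · rintro ⟨j, rfl⟩
        exact ⟨j, j.2, rfl⟩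
    rw [hWspan, h1]
    simpa [Set.finrank] using finrank_range_le_card (R := ℝ) (fun j : Fin k => pick (W j))
  have hWne : ∀ k < m, W k ≠ ⊤ := by
    intro k hk h
    have := hWle k
    rw [h, finrank_top, finrank_euclideanSpace_fin] at this
    omega
  have hWge : ∀ k ≤ m, k ≤ Module.finrank ℝ (W k) := by
    intro k
    induction k with
    | zero => simp
    | succ k ih =>
      intro hk
      refine Nat.succ_le_of_lt ((ih (by omega)).trans_lt (Submodule.finrank_lt_finrank_of_lt ?_))
      rw [hWsucc]
      refine lt_of_le_of_ne le_sup_left fun h => (hpick _ (hWne k hk)).1 ?_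
      have h1 : pick (W k) ∈ W k ⊔ Submodule.span ℝ {pick (W k)} :=
        Submodule.mem_sup_right (Submodule.mem_span_singleton_self _)
      rwa [← h] at h1
  have hspan : ∀ i : Fin m, W i =
      Submodule.span ℝ ((fun j : Fin m => pick (W j)) '' Set.Iio i) := by
    intro i
    rw [hWspan]
    congr 1
    ext u
    constructor
    · rintro ⟨j, hj, rfl⟩
      exact ⟨⟨j, lt_trans hj i.2⟩, hj, rfl⟩
    · rintro ⟨j, hj, rfl⟩
      exact ⟨j, hj, rfl⟩
  refine ⟨fun i => pick (W i), fun i => hpickmem _, ?_, fun i => ?_⟩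
  · refine linearIndependent_of_top_le_span_of_card_eq_finrank ?_ (by simp)
    have hWm : W m = ⊤ := Submodule.eq_top_of_finrank_eq (by
      rw [finrank_euclideanSpace_fin]; exact le_antisymm (hWle m) (hWge m le_rfl))
    rw [← hWm, hWspan]
    refine Submodule.span_mono ?_
    rintro _ ⟨j, hj, rfl⟩
    exact ⟨⟨j, hj⟩, rfl⟩
  · rw [← hspan]
    exact (hpick _ (hWne i i.2)).2

theorem volume_fundamentalDomain_orthonormalBasis {ι E : Type*} [Fintype ι] [NormedAddCommGroup E]
    [InnerProductSpace ℝ E] [FiniteDimensional ℝ E] [MeasurableSpace E] [BorelSpace E]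
    (b : OrthonormalBasis ι ℝ E) :
    MeasureTheory.volume (ZSpan.fundamentalDomain b.toBasis) = 1 := by
  rw [MeasureTheory.measure_congr (ZSpan.fundamentalDomain_ae_parallelepiped _ _),
    OrthonormalBasis.coe_toBasis, OrthonormalBasis.volume_parallelepiped]

/-- Minkowski's second theorem, up to a constant: independent integer vectors whose images under
`g` have a controlled product of norms. -/
theorem exists_linearIndependent_prod_norm_le {m : ℕ} (hm : 0 < m)
    (g : EuclideanSpace ℝ (Fin m) ≃ₗ[ℝ] EuclideanSpace ℝ (Fin m)) :
    ∃ v : Fin m → EuclideanSpace ℝ (Fin m), (∀ i, v i ∈ integerLattice m) ∧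
      LinearIndependent ℝ v ∧ Monotone (fun i => ‖g (v i)‖) ∧
      ∏ i, ‖g (v i)‖ ≤ √m ^ m * |LinearMap.det (g : EuclideanSpace ℝ (Fin m) →ₗ[ℝ] _)| := by
  obtain ⟨v, hv, hli, hmin⟩ := exists_successive_minima g
  have hmono : Monotone (fun i => ‖g (v i)‖) := by
    intro i j hij
    exact hmin i _ (hv j) (hli.notMem_span_image (not_lt.2 hij))
  refine ⟨v, hv, hli, hmono, ?_⟩
  have hpos : ∀ i, 0 < ‖g (v i)‖ := fun i => by
    simpa using hli.ne_zero i
  have hm' : (0 : ℝ) < m := by exact_mod_cast hm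
  have hsq : 0 < √(m : ℝ) := Real.sqrt_pos.2 hm'
  -- In this basis the image under `g` of the span of `v 0, …, v i` has only its first `i + 1`
  -- coordinates nonzero.
  let e := InnerProductSpace.gramSchmidtOrthonormalBasis (𝕜 := ℝ) (by simp)
    (fun i => g (v i))
  let r : Fin m → ℝ := fun i => ‖g (v i)‖ / √m
  let box : Set (Fin m → ℝ) := Set.pi Set.univ fun i => Set.Ioo (-r i) (r i)
  let B : Set (EuclideanSpace ℝ (Fin m)) := e.repr ⁻¹' (WithLp.ofLp ⁻¹' box)
  have hbox : MeasurableSet box := MeasurableSet.univ_pi fun i => measurableSet_Ioo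
  have hBvol : MeasureTheory.volume B = ENNReal.ofReal (∏ i, (2 * r i)) := by
    rw [e.measurePreserving_repr.measure_preimage
      ((PiLp.volume_preserving_ofLp (Fin m)).measurable hbox).nullMeasurableSet,
      (PiLp.volume_preserving_ofLp (Fin m)).measure_preimage hbox.nullMeasurableSet,
      MeasureTheory.volume_pi, MeasureTheory.Measure.pi_pi,
      ENNReal.ofReal_prod_of_nonneg fun i _ => by have := hpos i; positivity]
    simp only [Real.volume_Ioo]
    congr! 2
    ring
  have hdet : LinearMap.det (g : EuclideanSpace ℝ (Fin m) →ₗ[ℝ] _) ≠ 0 := g.isUnit_det'.ne_zero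
  -- If the product were larger, the preimage under `g` of the box with half-sides `‖g (v i)‖ / √m`
  -- would have volume above `2 ^ m` and so contain an integer vector `x ≠ 0`.
  by_contra! hlt
  have hvol : MeasureTheory.volume
      (ZSpan.fundamentalDomain (EuclideanSpace.basisFun (Fin m) ℝ).toBasis) *
      2 ^ Module.finrank ℝ (EuclideanSpace ℝ (Fin m)) <
      MeasureTheory.volume (g.toLinearMap ⁻¹' B) := by
    rw [volume_fundamentalDomain_orthonormalBasis,
      MeasureTheory.Measure.addHaar_preimage_linearMap _ hdet, hBvol, one_mul,
      finrank_euclideanSpace_fin, ← ENNReal.ofReal_mul (by positivity),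
      show (2 : ENNReal) ^ m = ENNReal.ofReal (2 ^ m) by
        rw [ENNReal.ofReal_pow (by norm_num), ENNReal.ofReal_ofNat]]
    refine (ENNReal.ofReal_lt_ofReal_iff_of_nonneg (by positivity)).2 ?_
    simp only [r]
    rw [Finset.prod_mul_distrib, Finset.prod_div_distrib, abs_inv]
    simp only [Finset.prod_const, Finset.card_univ, Fintype.card_fin]
    rw [inv_mul_eq_div, lt_div_iff₀ (abs_pos.2 hdet)]
    have : √(m : ℝ) ^ m ≠ 0 := by positivity
    refine mul_lt_mul_of_pos_left ?_ (by positivity)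
    rw [lt_div_iff₀ (by positivity), mul_comm]
    exact hlt
  have hsymm : ∀ x ∈ g.toLinearMap ⁻¹' B, -x ∈ g.toLinearMap ⁻¹' B := by
    intro x hx i hi
    have := hx i hi
    simp only [Set.mem_Ioo, map_neg, PiLp.neg_apply] at this ⊢
    constructor <;> linarith
  have hconv : Convex ℝ (g.toLinearMap ⁻¹' B) :=
    ((convex_pi fun i _ => convex_Ioo _ _).linear_preimage
      ((WithLp.linearEquiv 2 ℝ (Fin m → ℝ)).toLinearMap ∘ₗ e.repr.toLinearMap)).linear_preimage _
  have : Countable (Submodule.span ℤ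
      (Set.range (EuclideanSpace.basisFun (Fin m) ℝ).toBasis)).toAddSubgroup :=
    inferInstanceAs (Countable (Submodule.span ℤ
      (Set.range (EuclideanSpace.basisFun (Fin m) ℝ).toBasis)))
  obtain ⟨⟨x, hx⟩, hx0, hxB⟩ :=
    MeasureTheory.exists_ne_zero_mem_lattice_of_measure_mul_two_pow_lt_measure
      (ZSpan.isAddFundamentalDomain' (EuclideanSpace.basisFun (Fin m) ℝ).toBasis
        MeasureTheory.volume) hsymm hconv hvol
  replace hx : x ∈ integerLattice m := by rw [integerLattice_eq_span]; exact hx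
  replace hx0 : x ≠ 0 := fun h => hx0 (Subtype.ext h)
  have hex : ∃ j : ℕ, x ∈ Submodule.span ℝ (v '' {i | i.val < j}) := by
    refine ⟨m, ?_⟩
    have : {i : Fin m | i.val < m} = Set.univ := by ext i; simp
    rw [this, Set.image_univ, hli.span_eq_top_of_card_eq_finrank' (by simp)]
    trivial
  -- For the first step `i` of the flag containing `x`, minimality gives `‖g (v i)‖ ≤ ‖g x‖`. But
  -- the coordinates of `g x` after `i` vanish and the others are below `r i`, so `‖g x‖ ^ 2 < m * r
  -- i ^ 2 = ‖g (v i)‖ ^ 2`.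
  obtain ⟨i, hi1, hi2⟩ : ∃ i : Fin m, x ∈ Submodule.span ℝ (v '' Set.Iic i) ∧
      x ∉ Submodule.span ℝ (v '' Set.Iio i) := by
    classical
    obtain ⟨k, hk⟩ : ∃ k, Nat.find hex = k + 1 := by
      refine Nat.exists_eq_succ_of_ne_zero fun h => hx0 ?_
      simpa [h] using Nat.find_spec hex
    have hspec := Nat.find_spec hex
    have hnot := Nat.find_min hex (m := k) (by omega)
    rw [hk] at hspec
    have hkm : k < m := by
      by_contra! hmk
      refine hnot (Submodule.span_mono (Set.image_mono fun i _ => ?_) hspec)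
      exact lt_of_lt_of_le i.2 hmk
    refine ⟨⟨k, hkm⟩, ?_, hnot⟩
    convert! hspec using 4
    ext i
    simp [Fin.le_def]
  have hle := hmin i x hx hi2
  have hzero : ∀ l, i < l → e.repr (g x) l = 0 := by
    intro l hl
    have : Submodule.span ℝ (v '' Set.Iic i) ≤
        (EuclideanSpace.projₗ l ∘ₗ e.repr.toLinearMap ∘ₗ g.toLinearMap).ker := by
      rw [Submodule.span_le]
      rintro _ ⟨j, hj, rfl⟩
      exact InnerProductSpace.gramSchmidtOrthonormalBasis_inv_triangular' _ _ (lt_of_le_of_lt hj hl)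
    exact this hi1
  have hcoord : ∀ l, e.repr (g x) l ^ 2 < r i ^ 2 := by
    intro l
    have hri : 0 < r i := div_pos (hpos i) hsq
    rcases le_or_gt l i with hl | hl
    · rw [sq_lt_sq, abs_of_pos hri]
      refine (abs_lt.2 (hxB l trivial)).trans_le ?_
      exact div_le_div_of_nonneg_right (hmono hl) hsq.le
    · rw [hzero l hl, zero_pow two_ne_zero]
      positivity
  have hlt' : ‖g x‖ ^ 2 < ‖g (v i)‖ ^ 2 := by
    rw [← e.repr.norm_map (g x), EuclideanSpace.norm_sq_eq]
    calc ∑ l, ‖e.repr (g x) l‖ ^ 2 < ∑ _l : Fin m, r i ^ 2 := by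
          refine Finset.sum_lt_sum_of_nonempty ⟨i, Finset.mem_univ _⟩ fun l _ => ?_
          simpa using hcoord l
      _ = ‖g (v i)‖ ^ 2 := by
          simp only [r, div_pow, Real.sq_sqrt hm'.le, Finset.sum_const, Finset.card_univ,
            Fintype.card_fin, nsmul_eq_mul]
          field_simp
  exact absurd (pow_le_pow_left₀ (norm_nonneg _) hle 2) (not_le.2 hlt')

/-! ### Bounding heights by determinants -/

/-- In a lattice basis the `v i` have an integer coordinate matrix, whose determinant is nonzero by
independence and hence at least 1 in absolute value. -/
theorem covolume_le_abs_det {E ι : Type*} [Fintype ι] [DecidableEq ι] [NormedAddCommGroup E]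
    [InnerProductSpace ℝ E] [FiniteDimensional ℝ E] [MeasurableSpace E] [BorelSpace E]
    (Λ : Submodule ℤ E) [DiscreteTopology Λ] [IsZLattice ℝ Λ] (e : OrthonormalBasis ι ℝ E)
    {v : ι → E} (hv : ∀ i, v i ∈ Λ) (hli : LinearIndependent ℝ v) :
    ZLattice.covolume Λ ≤ |e.toBasis.det v| := by
  have hrank : Module.finrank ℤ Λ = Fintype.card ι := by
    rw [ZLattice.rank ℝ Λ, Module.finrank_eq_card_basis e.toBasis]
  let b : Module.Basis ι ℤ Λ := (Module.finBasis ℤ Λ).reindex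
    (Fintype.equivOfCardEq (by rw [Fintype.card_fin, hrank]))
  let B := b.ofZLatticeBasis ℝ Λ
  have hB : ⇑B = (↑) ∘ b := by
    ext i
    exact b.ofZLatticeBasis_apply ℝ Λ i
  let P : Matrix ι ι ℤ := Matrix.of fun i j => b.repr ⟨v j, hv j⟩ i
  have hP : B.toMatrix v = P.map (Int.castRingHom ℝ) := by
    ext i j
    exact b.ofZLatticeBasis_repr_apply ℝ Λ ⟨v j, hv j⟩ i
  have hdet : e.toBasis.det v = e.toBasis.det B * (P.det : ℝ) := by
    rw [Module.Basis.det_apply, Module.Basis.det_apply,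
      ← Module.Basis.toMatrix_mul_toMatrix e.toBasis B v, Matrix.det_mul, hP,
      ← RingHom.mapMatrix_apply, ← RingHom.map_det]
    rfl
  have hne : P.det ≠ 0 := by
    intro h0
    have : e.toBasis.det v ≠ 0 :=
      (((Module.Basis.is_basis_iff_det e.toBasis).1
        ⟨hli, hli.span_eq_top_of_card_eq_finrank' (Module.finrank_eq_card_basis e.toBasis).symm⟩)).ne_zero
    exact this (by rw [hdet, h0]; simp)
  have h1 : (1 : ℝ) ≤ |(P.det : ℝ)| := by exact_mod_cast Int.one_le_abs hne
  rw [ZLattice.covolume_eq_det_mul_measureReal Λ _ b e.toBasis, MeasureTheory.measureReal_def,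
    volume_fundamentalDomain_orthonormalBasis, hdet, abs_mul, hB]
  simpa using le_mul_of_one_le_right (abs_nonneg _) h1

/-- Hadamard's inequality. -/
theorem abs_det_le_prod_norm {E : Type*} {k : ℕ} [NormedAddCommGroup E]
    [InnerProductSpace ℝ E] (e : OrthonormalBasis (Fin k) ℝ E) (v : Fin k → E) :
    |e.toBasis.det v| ≤ ∏ i, ‖v i‖ := by
  have : Fact (Module.finrank ℝ E = k) := ⟨by simpa using Module.finrank_eq_card_basis e.toBasis⟩
  rw [← e.toBasis.orientation.volumeForm_robust' e v]
  exact Orientation.abs_volumeForm_apply_le _ _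

theorem det_sub_smul_eq {E ι : Type*} [Fintype ι] [DecidableEq ι] [AddCommGroup E] [Module ℝ E]
    (e : Module.Basis ι ℝ E) (v : ι → E) (c : ι → ℝ) {k : ι} (hk : c k = 0) :
    e.det (fun i => v i - c i • v k) = e.det v := by
  rw [Module.Basis.det_apply, Module.Basis.det_apply, ← Matrix.det_transpose,
    ← Matrix.det_transpose (e.toMatrix v)]
  refine Matrix.det_eq_of_forall_row_eq_smul_add_const (fun i => -c i) k (by simp [hk])
    fun i j => ?_
  simp [Module.Basis.toMatrix_apply, sub_eq_add_neg]

/-- Subtracting multiples of `v 0` preserves the determinant but can shorten the vectors greatly;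
Hadamard is applied only afterwards. -/
theorem height_pos_and_le {n d : ℕ} {L : AffineSubspace ℝ (Fin n → ℝ)}
    (hL : Module.finrank ℝ (coneSpan L) = d + 1)
    {v : Fin (d + 1) → EuclideanSpace ℝ (Fin (n + 1))} (hv : ∀ i, v i ∈ integerLattice (n + 1))
    (hvL : ∀ i, v i ∈ coneSpan L) (hli : LinearIndependent ℝ v) (c : Fin (d + 1) → ℝ)
    (hc : c 0 = 0) :
    0 < height L ∧ height L ≤ ∏ i, ‖v i - c i • v 0‖ := by
  let Λ := ZLattice.comap ℝ (integerLattice (n + 1)) (coneSpan L).subtype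
  let w : Fin (d + 1) → coneSpan L := fun i => ⟨v i, hvL i⟩
  have hw : ∀ i, w i ∈ Λ := hv
  have hwli : LinearIndependent ℝ w := LinearIndependent.of_comp (coneSpan L).subtype hli
  have : DiscreteTopology Λ := ZLattice.comap_discreteTopology ℝ _
    (coneSpan L).subtypeL.continuous Subtype.val_injective
  have : IsZLattice ℝ Λ := ⟨by
    rw [eq_top_iff, ← hwli.span_eq_top_of_card_eq_finrank' (by simp [hL])]
    exact Submodule.span_mono (Set.range_subset_iff.2 hw)⟩
  have hvol : height L = ZLattice.covolume Λ := by
    rw [height, subspaceVolume, OrthonormalBasis.addHaar_eq_volume]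
  let e := (stdOrthonormalBasis ℝ (coneSpan L)).reindex (finCongr hL)
  rw [hvol]
  refine ⟨ZLattice.covolume_pos Λ _, (covolume_le_abs_det Λ e hw hwli).trans ?_⟩
  rw [← det_sub_smul_eq e.toBasis w c hc]
  exact abs_det_le_prod_norm e _

/-! ### Rational subspaces from integer vectors -/

/-- The embedding `w ↦ (w, 0)` of `ℝⁿ` into Euclidean `ℝⁿ⁺¹`. -/
def embedDirection (n : ℕ) : (Fin n → ℝ) →ₗ[ℝ] EuclideanSpace ℝ (Fin (n + 1)) where
  toFun w := WithLp.toLp 2 (Fin.snoc (α := fun _ => ℝ) w 0)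
  map_add' x y := by
    ext i
    refine Fin.lastCases ?_ (fun j => ?_) i <;> simp
  map_smul' a x := by
    ext i
    refine Fin.lastCases ?_ (fun j => ?_) i <;> simp

theorem homogenize_add {n : ℕ} (y w : Fin n → ℝ) :
    homogenize (y + w) = homogenize y + embedDirection n w := by
  ext i
  refine Fin.lastCases ?_ (fun j => ?_) i <;> simp [homogenize, embedDirection]

theorem isRationalSubspace_mk' {n d : ℕ} {p : Fin n → ℝ} {w : Fin d → Fin n → ℝ}
    (hp : ∀ i, ∃ r : ℚ, (r : ℝ) = p i) (hw : ∀ j i, ∃ r : ℚ, (r : ℝ) = w j i)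
    (hli : LinearIndependent ℝ w) :
    IsRationalSubspace d (AffineSubspace.mk' p (Submodule.span ℝ (Set.range w))) := by
  choose r hr using hp
  choose s hs using hw
  refine ⟨⟨p, AffineSubspace.self_mem_mk' _ _⟩, ?_, le_antisymm ?_ ?_⟩
  · rw [AffineSubspace.direction_mk', finrank_span_eq_card hli, Fintype.card_fin]
  · exact affineSpan_le.2 fun y hy => hy.1
  · set S := affineSpan ℝ {y : Fin n → ℝ |
      y ∈ AffineSubspace.mk' p (Submodule.span ℝ (Set.range w)) ∧
        ∃ r : Fin n → ℚ, ∀ i, y i = (r i : ℝ)}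
    have hpS : p ∈ S := subset_affineSpan ℝ _
      ⟨AffineSubspace.self_mem_mk' _ _, r, fun i => (hr i).symm⟩
    have hwS : Submodule.span ℝ (Set.range w) ≤ S.direction := by
      rw [Submodule.span_le]
      rintro _ ⟨j, rfl⟩
      have h1 : w j + p ∈ S := by
        refine subset_affineSpan ℝ _ ⟨?_, fun i => s j i + r i, fun i => ?_⟩
        · rw [AffineSubspace.mem_mk', vsub_eq_sub, add_sub_cancel_right]
          exact Submodule.subset_span ⟨j, rfl⟩
        · simp [hr, hs]
      simpa using AffineSubspace.vsub_mem_direction h1 hpS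
    intro y hy
    have h2 : y - p ∈ S.direction := hwS (by simpa using AffineSubspace.mem_mk'.1 hy)
    simpa using AffineSubspace.vadd_mem_of_mem_direction h2 hpS

/-- The rational affine subspace cut out by the span of independent integer vectors. -/
theorem exists_rationalSubspace {n d : ℕ}
    {v : Fin (d + 1) → EuclideanSpace ℝ (Fin (n + 1))} (hv : ∀ i, v i ∈ integerLattice (n + 1))
    (hli : LinearIndependent ℝ v) (hq : v 0 (Fin.last n) ≠ 0) :
    ∃ L : AffineSubspace ℝ (Fin n → ℝ), IsRationalSubspace d L ∧
      (fun j : Fin n => v 0 j.castSucc / v 0 (Fin.last n)) ∈ L ∧ 0 < height L ∧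
      height L ≤ ‖v 0‖ * ∏ j : Fin d, ‖v j.succ -
        (v j.succ (Fin.last n) / v 0 (Fin.last n)) • v 0‖ := by
  set q := v 0 (Fin.last n)
  -- `p` is where the line of `v 0` meets the hyperplane of last coordinate 1; the `u j` have last
  -- coordinate 0 and so give directions.
  let p : Fin n → ℝ := fun i => v 0 i.castSucc / q
  let u : Fin d → EuclideanSpace ℝ (Fin (n + 1)) :=
    fun j => v j.succ - (v j.succ (Fin.last n) / q) • v 0
  let w : Fin d → Fin n → ℝ := fun j i => u j i.castSucc
  have hwu : ∀ j, embedDirection n (w j) = u j := by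
    intro j
    ext i
    refine Fin.lastCases ?_ (fun j => ?_) i
    · simp [embedDirection, u, q, hq]
    · simp [embedDirection, w]
  have hp0 : v 0 = q • homogenize p := by
    ext i
    refine Fin.lastCases ?_ (fun j => ?_) i
    · simp [homogenize, q]
    · simp [homogenize, p, mul_div_cancel₀ _ hq]
  have hint : ∀ i l, ∃ a : ℤ, (a : ℝ) = v i l := fun i => mem_integerLattice_iff.1 (hv i)
  choose a ha using hint
  have hp : ∀ i, ∃ r : ℚ, (r : ℝ) = p i := fun i =>
    ⟨a 0 i.castSucc / a 0 (Fin.last n), by simp [p, q, ha]⟩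
  have hw : ∀ j i, ∃ r : ℚ, (r : ℝ) = w j i := fun j i =>
    ⟨a j.succ i.castSucc - a j.succ (Fin.last n) / a 0 (Fin.last n) * a 0 i.castSucc, by
      simp [w, u, q, ha]⟩
  have hwli : LinearIndependent ℝ w := by
    refine LinearIndependent.of_comp (embedDirection n) ?_
    have hcomp : ⇑(embedDirection n) ∘ w = u := funext hwu
    rw [hcomp, Fintype.linearIndependent_iff]
    intro c hc j
    -- A relation among the `u j` is one among the `v i` once the multiples of `v 0` are collected
    -- into its coefficient.
    have := Fintype.linearIndependent_iff.1 hli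
      (Fin.cons (-∑ j, c j * (v j.succ (Fin.last n) / q)) c) (by
        rw [Fin.sum_univ_succ, ← hc]
        simp [u, smul_sub, Finset.sum_sub_distrib, smul_smul, Finset.sum_smul, neg_add_eq_sub]) j.succ
    simpa using this
  let L := AffineSubspace.mk' p (Submodule.span ℝ (Set.range w))
  have hpL : p ∈ L := AffineSubspace.self_mem_mk' _ _
  have hwL : ∀ j, p + w j ∈ L := fun j => by
    rw [AffineSubspace.mem_mk', vsub_eq_sub, add_sub_cancel_left]
    exact Submodule.subset_span ⟨j, rfl⟩
  have hcone : ∀ y ∈ L, homogenize y ∈ coneSpan L := fun y hy =>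
    Submodule.subset_span ⟨y, hy, rfl⟩
  have hv0 : v 0 ∈ coneSpan L := by
    rw [hp0]; exact Submodule.smul_mem _ _ (hcone p hpL)
  have hvL : ∀ i, v i ∈ coneSpan L := by
    intro i
    refine Fin.cases hv0 (fun j => ?_) i
    have h1 : u j ∈ coneSpan L := by
      have := Submodule.sub_mem _ (hcone _ (hwL j)) (hcone p hpL)
      rwa [homogenize_add, add_sub_cancel_left, hwu] at this
    have h2 : v j.succ = u j + (v j.succ (Fin.last n) / q) • v 0 := by simp [u]
    rw [h2]
    exact Submodule.add_mem _ h1 (Submodule.smul_mem _ _ hv0)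
  have hspan : coneSpan L = Submodule.span ℝ (Set.range v) := by
    have hvs : ∀ i, v i ∈ Submodule.span ℝ (Set.range v) := fun i =>
      Submodule.subset_span ⟨i, rfl⟩
    refine le_antisymm (Submodule.span_le.2 ?_)
      (Submodule.span_le.2 (Set.range_subset_iff.2 hvL))
    rintro _ ⟨y, hy, rfl⟩
    have hy' : y - p ∈ Submodule.span ℝ (Set.range w) := AffineSubspace.mem_mk'.1 hy
    have hle : Submodule.span ℝ (Set.range w) ≤
        (Submodule.span ℝ (Set.range v)).comap (embedDirection n) := by
      rw [Submodule.span_le]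
      rintro _ ⟨j, rfl⟩
      simp only [Submodule.comap_coe, Set.mem_preimage, SetLike.mem_coe]
      rw [hwu]
      exact Submodule.sub_mem _ (hvs _) (Submodule.smul_mem _ _ (hvs 0))
    have h1 : homogenize y = homogenize p + embedDirection n (y - p) := by
      rw [← homogenize_add, add_sub_cancel]
    have h2 : homogenize p = q⁻¹ • v 0 := by rw [hp0, inv_smul_smul₀ hq]
    rw [h1, h2]
    exact Submodule.add_mem _ (Submodule.smul_mem _ _ (hvs 0)) (hle hy')
  have hfin : Module.finrank ℝ (coneSpan L) = d + 1 := by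
    rw [hspan, finrank_span_eq_card hli, Fintype.card_fin]
  obtain ⟨h1, h2⟩ := height_pos_and_le hfin hv hvL hli
    (Fin.cons 0 fun j => v j.succ (Fin.last n) / q) rfl
  refine ⟨L, isRationalSubspace_mk' hp hw hwli, hpL, h1, ?_⟩
  rw [Fin.prod_univ_succ] at h2
  simpa using h2

/-! ### Integer vectors near the line through `(x, 1)` -/

/-- The linear map `(p, q) ↦ (B⁻¹ (p - q x), A⁻¹ q)` of `ℝⁿ⁺¹`. -/
def shear {n : ℕ} (x : Fin n → ℝ) (A B : ℝ) :
    EuclideanSpace ℝ (Fin (n + 1)) →ₗ[ℝ] EuclideanSpace ℝ (Fin (n + 1)) where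
  toFun v := B⁻¹ • (v - v (Fin.last n) • homogenize x) +
    (A⁻¹ * v (Fin.last n)) • EuclideanSpace.single (Fin.last n) 1
  map_add' u v := by
    simp only [PiLp.add_apply]
    module
  map_smul' a v := by
    simp only [PiLp.smul_apply, smul_eq_mul, RingHom.id_apply]
    module

theorem shear_last {n : ℕ} (x : Fin n → ℝ) (A B : ℝ) (v : EuclideanSpace ℝ (Fin (n + 1))) :
    shear x A B v (Fin.last n) = A⁻¹ * v (Fin.last n) := by
  simp [shear, homogenize]

theorem shear_castSucc {n : ℕ} (x : Fin n → ℝ) (A B : ℝ) (v : EuclideanSpace ℝ (Fin (n + 1)))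
    (j : Fin n) :
    shear x A B v j.castSucc = B⁻¹ * (v j.castSucc - v (Fin.last n) * x j) := by
  simp [shear, homogenize]

theorem det_shear {n : ℕ} (x : Fin n → ℝ) (A B : ℝ) :
    LinearMap.det (shear x A B) = A⁻¹ * B⁻¹ ^ n := by
  let b := (EuclideanSpace.basisFun (Fin (n + 1)) ℝ).toBasis
  have hM : ∀ i j, LinearMap.toMatrix b b (shear x A B) i j =
      shear x A B (EuclideanSpace.single j 1) i := by
    intro i j
    simp [b, LinearMap.toMatrix_apply]
  rw [← LinearMap.det_toMatrix b, Matrix.det_of_isUpperTriangular, Fin.prod_univ_castSucc]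
  · simp only [hM, shear_last, shear_castSucc]
    simp [mul_comm]
  · intro i j hij
    rw [hM]
    simp only [id] at hij
    revert hij
    refine Fin.lastCases (fun hij => ?_) (fun i hij => ?_) i
    · simp [shear_last, hij.ne']
    · have hj : j ≠ Fin.last n := (hij.trans (Fin.castSucc_lt_last i)).ne
      simp [shear_castSucc, hij.ne', hj.symm]

theorem abs_last_le_norm_shear {n : ℕ} (x : Fin n → ℝ) {A : ℝ} (B : ℝ) (hA : 0 < A)
    (v : EuclideanSpace ℝ (Fin (n + 1))) :
    |v (Fin.last n)| ≤ ‖shear x A B v‖ * A := by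
  have h := PiLp.norm_apply_le (shear x A B v) (Fin.last n)
  rw [shear_last, Real.norm_eq_abs, abs_mul, abs_of_pos (inv_pos.2 hA), inv_mul_le_iff₀ hA] at h
  linarith

theorem norm_sub_le_norm_shear {n : ℕ} (x : Fin n → ℝ) (A : ℝ) {B : ℝ} (hB : 0 < B)
    (v : EuclideanSpace ℝ (Fin (n + 1))) :
    ‖v - v (Fin.last n) • homogenize x‖ ≤ ‖shear x A B v‖ * B := by
  refine (sq_le_sq₀ (norm_nonneg _) (by positivity)).1 ?_
  rw [mul_pow, EuclideanSpace.norm_sq_eq, EuclideanSpace.norm_sq_eq, Fin.sum_univ_castSucc,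
    Fin.sum_univ_castSucc, add_mul, Finset.sum_mul]
  refine add_le_add (Finset.sum_le_sum fun j _ => le_of_eq ?_) ?_
  · rw [shear_castSucc, Real.norm_eq_abs, Real.norm_eq_abs, sq_abs, sq_abs]
    simp [homogenize]
    field_simp
  · simp only [homogenize, PiLp.sub_apply, PiLp.smul_apply, Fin.snoc_last, smul_eq_mul, mul_one,
      sub_self, norm_zero, zero_pow two_ne_zero]
    positivity

/-- Either all dropped factors are at least 1, or one is below 1 and then, by monotonicity, so is
every kept factor. -/
theorem prod_castAdd_le {k l : ℕ} {r : Fin (k + l) → ℝ} (hr : Monotone r) (hpos : ∀ i, 0 < r i)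
    {C : ℝ} (hC : 1 ≤ C) (hle : ∏ i, r i ≤ C) : ∏ i, r (Fin.castAdd l i) ≤ C := by
  by_cases h : ∀ j, 1 ≤ r (Fin.natAdd k j)
  · rw [Fin.prod_univ_add] at hle
    refine le_trans (le_mul_of_one_le_right (Finset.prod_nonneg fun i _ => (hpos _).le) ?_) hle
    simpa using Finset.prod_le_prod (s := Finset.univ) (fun _ _ => zero_le_one) fun j _ => h j
  · push Not at h
    obtain ⟨j, hj⟩ := h
    refine le_trans (Finset.prod_le_one (fun i _ => (hpos _).le) fun i _ => ?_) hC
    refine (hr ?_).trans hj.le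
    simp only [Fin.le_def, Fin.val_castAdd, Fin.val_natAdd]
    omega

/-- The `r i` are the sheared lengths of the first `d + 1` vectors realising the successive minima;
`C` is independent of `A` and `B`. -/
theorem exists_linearIndependent_near {n d : ℕ} (hd : d < n) (x : Fin n → ℝ) :
    ∃ C : ℝ, 1 ≤ C ∧ ∀ A B : ℝ, 0 < A → 0 < B → A * B ^ n = 1 →
      ∃ (v : Fin (d + 1) → EuclideanSpace ℝ (Fin (n + 1))) (r : Fin (d + 1) → ℝ),
        (∀ i, v i ∈ integerLattice (n + 1)) ∧ LinearIndependent ℝ v ∧ (∀ i, 0 < r i) ∧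
        ∏ i, r i ≤ C ∧ (∀ i, |v i (Fin.last n)| ≤ r i * A) ∧
        ∀ i, ‖v i - v i (Fin.last n) • homogenize x‖ ≤ r i * B := by
  refine ⟨max 1 (√((n + 1 : ℕ) : ℝ) ^ (n + 1)), le_max_left _ _, fun A B hA hB hAB => ?_⟩
  have hdet : LinearMap.det (shear x A B) = 1 := by
    rw [det_shear, inv_pow, ← mul_inv, hAB, inv_one]
  let g := (shear x A B).equivOfDetNeZero (by rw [hdet]; exact one_ne_zero)
  obtain ⟨v, hv, hli, hmono, hprod⟩ := exists_linearIndependent_prod_norm_le n.succ_pos g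
  have hg : ∀ u, g u = shear x A B u := fun u => rfl
  have hgdet : LinearMap.det (g : EuclideanSpace ℝ (Fin (n + 1)) →ₗ[ℝ] _) = 1 := hdet
  rw [hgdet, abs_one, mul_one] at hprod
  obtain ⟨l, hl⟩ : ∃ l, d + 1 + l = n + 1 := ⟨n - d, by omega⟩
  let f : Fin (d + 1) → Fin (n + 1) := fun i => Fin.cast hl (Fin.castAdd l i)
  have hf : Function.Injective f := fun i j hij => by
    simpa [f] using hij
  have hpos : ∀ i, 0 < ‖g (v i)‖ := fun i => by simpa using hli.ne_zero i
  refine ⟨v ∘ f, fun i => ‖g (v (f i))‖, fun i => hv _, hli.comp f hf, fun i => hpos _, ?_,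
    fun i => abs_last_le_norm_shear x B hA _, fun i => norm_sub_le_norm_shear x A hB _⟩
  refine prod_castAdd_le (r := fun i => ‖g (v (Fin.cast hl i))‖) (fun i j hij => hmono hij)
    (fun i => hpos _) (le_max_left _ _) (le_trans (le_of_eq ?_) (hprod.trans (le_max_right _ _)))
  exact Fintype.prod_equiv (finCongr hl) _ _ fun i => rfl

/-! ### Distance and height of the approximating subspace -/

theorem one_le_norm_of_mem_integerLattice {m : ℕ} {v : EuclideanSpace ℝ (Fin m)}
    (hv : v ∈ integerLattice m) (h0 : v ≠ 0) : 1 ≤ ‖v‖ := by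
  obtain ⟨i, hi⟩ : ∃ i, v i ≠ 0 := by
    by_contra! h
    exact h0 (by ext i; simpa using h i)
  obtain ⟨a, ha⟩ := mem_integerLattice_iff.1 hv i
  refine le_trans ?_ (PiLp.norm_apply_le v i)
  rw [← ha] at hi ⊢
  have : a ≠ 0 := fun h => hi (by simp [h])
  rw [Real.norm_eq_abs]
  exact_mod_cast Int.one_le_abs this

/-- The subspace spanned by independent integer vectors close to the line through `(x, 1)`, the
first of which has the relatively largest last coordinate. -/
theorem exists_rationalSubspace_near_of_max {n d : ℕ} (x : Fin n → ℝ) {A B C : ℝ} (hB : 0 < B)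
    {v : Fin (d + 1) → EuclideanSpace ℝ (Fin (n + 1))} {r : Fin (d + 1) → ℝ}
    (hv : ∀ i, v i ∈ integerLattice (n + 1)) (hli : LinearIndependent ℝ v)
    (hr : ∀ i, 0 < r i) (hC : ∏ i, r i ≤ C)
    (hlast : ∀ i, |v i (Fin.last n)| ≤ r i * A)
    (hnear : ∀ i, ‖v i - v i (Fin.last n) • homogenize x‖ ≤ r i * B)
    (hmax : ∀ i, |v i (Fin.last n)| / r i ≤ |v 0 (Fin.last n)| / r 0)
    (hsmall : (‖homogenize x‖ + 1) ^ (d + 1) * C * B ^ (d + 1) < 1) :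
    ∃ L : AffineSubspace ℝ (Fin n → ℝ), IsRationalSubspace d L ∧ 0 < height L ∧
      height L ≤ (‖homogenize x‖ + 1) * 2 ^ d * C * (A * B ^ d) ∧
      Metric.infDist x (L : Set (Fin n → ℝ)) * height L ≤
        (‖homogenize x‖ + 1) * 2 ^ d * C * B ^ (d + 1) := by
  set X := ‖homogenize x‖
  have hX : 0 ≤ X := norm_nonneg _
  have hnorm : ∀ i, ‖v i‖ ≤ r i * B + |v i (Fin.last n)| * X := by
    intro i
    calc ‖v i‖ = ‖(v i - v i (Fin.last n) • homogenize x) + v i (Fin.last n) • homogenize x‖ := by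
          rw [sub_add_cancel]
      _ ≤ _ := by
        refine (norm_add_le _ _).trans (add_le_add (hnear i) ?_)
        rw [norm_smul, Real.norm_eq_abs]
  -- Otherwise, by maximality, every last coordinate is below `r i * B`, so all `v i` are so short
  -- that `hsmall` makes the product of their norms less than 1, impossible for nonzero integer
  -- vectors.
  have hq : r 0 * B ≤ |v 0 (Fin.last n)| := by
    by_contra! hlt
    have h1 : ∀ i, ‖v i‖ ≤ (X + 1) * B * r i := by
      intro i
      have h2 : |v i (Fin.last n)| / r i < B :=
        (hmax i).trans_lt ((div_lt_iff₀ (hr 0)).2 (by linarith))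
      rw [div_lt_iff₀ (hr i)] at h2
      have := mul_le_mul_of_nonneg_right h2.le hX
      linarith [hnorm i]
    have h3 : (1 : ℝ) ≤ ∏ i, ‖v i‖ := by
      simpa using Finset.prod_le_prod (s := Finset.univ) (fun _ _ => zero_le_one) fun i _ =>
        one_le_norm_of_mem_integerLattice (hv i) (hli.ne_zero i)
    have h4 : ∏ i, ‖v i‖ ≤ ((X + 1) * B) ^ (d + 1) * C := by
      refine (Finset.prod_le_prod (fun i _ => norm_nonneg _) fun i _ => h1 i).trans ?_
      rw [Finset.prod_mul_distrib, Finset.prod_const, Finset.card_univ, Fintype.card_fin]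
      exact mul_le_mul_of_nonneg_left hC (by positivity)
    rw [mul_pow] at h4
    linarith
  have hqpos : 0 < |v 0 (Fin.last n)| := lt_of_lt_of_le (mul_pos (hr 0) hB) hq
  obtain ⟨L, hL, hpL, hpos, hle⟩ := exists_rationalSubspace hv hli (abs_pos.1 hqpos)
  set q := v 0 (Fin.last n)
  have hdiff : ∀ j : Fin d,
      ‖v j.succ - (v j.succ (Fin.last n) / q) • v 0‖ ≤ 2 * B * r j.succ := by
    intro j
    -- The multiples of `(x, 1)` cancel, leaving two errors of size at most `r j.succ * B`;
    -- maximality controls the second.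
    have h1 : v j.succ - (v j.succ (Fin.last n) / q) • v 0 =
        (v j.succ - v j.succ (Fin.last n) • homogenize x) -
          (v j.succ (Fin.last n) / q) • (v 0 - q • homogenize x) := by
      rw [smul_sub, smul_smul, div_mul_cancel₀ _ (abs_pos.1 hqpos)]
      abel
    have h2 : |v j.succ (Fin.last n) / q| * r 0 ≤ r j.succ := by
      have := hmax j.succ
      rw [div_le_div_iff₀ (hr _) (hr _)] at this
      rw [abs_div, div_mul_eq_mul_div, div_le_iff₀ hqpos]
      linarith
    rw [h1]
    refine (norm_sub_le _ _).trans ?_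
    rw [norm_smul, Real.norm_eq_abs]
    calc _ ≤ r j.succ * B + |v j.succ (Fin.last n) / q| * (r 0 * B) :=
          add_le_add (hnear _) (mul_le_mul_of_nonneg_left (hnear 0) (abs_nonneg _))
      _ ≤ r j.succ * B + r j.succ * B := by
          rw [← mul_assoc]; gcongr
      _ = _ := by ring
  set P := ∏ j : Fin d, r j.succ
  have hP : 0 ≤ P := Finset.prod_nonneg fun j _ => (hr _).le
  have hrP : r 0 * P ≤ C := by rwa [Fin.prod_univ_succ] at hC
  have hH : height L ≤ |q| * ((X + 1) * 2 ^ d * B ^ d * P) := by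
    refine hle.trans ?_
    calc _ ≤ (|q| * (X + 1)) * ∏ j : Fin d, (2 * B * r j.succ) := by
          refine mul_le_mul ?_ (Finset.prod_le_prod (fun j _ => norm_nonneg _) fun j _ => hdiff j)
            (Finset.prod_nonneg fun j _ => norm_nonneg _) (by positivity)
          linarith [hnorm 0]
      _ = _ := by
          rw [Finset.prod_mul_distrib, Finset.prod_const, Finset.card_univ, Fintype.card_fin,
            mul_pow]
          ring
  have hdist : Metric.infDist x (L : Set (Fin n → ℝ)) ≤ r 0 * B / |q| := by
    refine (Metric.infDist_le_dist_of_mem hpL).trans ((dist_pi_le_iff (by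
      have := hr 0; positivity)).2 fun j => ?_)
    have h1 := (PiLp.norm_apply_le (v 0 - q • homogenize x) j.castSucc).trans (hnear 0)
    rw [dist_comm, Real.dist_eq, le_div_iff₀ hqpos, ← abs_mul, sub_mul,
      div_mul_cancel₀ _ (abs_pos.1 hqpos)]
    simpa [homogenize, mul_comm] using h1
  refine ⟨L, hL, hpos, hH.trans ?_, ?_⟩
  · calc _ ≤ (r 0 * A) * ((X + 1) * 2 ^ d * B ^ d * P) :=
          mul_le_mul_of_nonneg_right (hlast 0) (by positivity)
      _ = ((X + 1) * 2 ^ d * (A * B ^ d)) * (r 0 * P) := by ring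
      _ ≤ ((X + 1) * 2 ^ d * (A * B ^ d)) * C := by
          have hA : 0 ≤ A := by
            have := (abs_nonneg _).trans (hlast 0)
            exact nonneg_of_mul_nonneg_right this (hr 0)
          gcongr
      _ = _ := by ring
  · calc _ ≤ (r 0 * B / |q|) * (|q| * ((X + 1) * 2 ^ d * B ^ d * P)) :=
          mul_le_mul hdist hH hpos.le (by have := hr 0; positivity)
      _ = ((X + 1) * 2 ^ d * B ^ (d + 1)) * (r 0 * P) := by
          field_simp
          ring
      _ ≤ ((X + 1) * 2 ^ d * B ^ (d + 1)) * C := by gcongr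
      _ = _ := by ring

/-- All hypotheses are invariant under permuting the vectors, so a maximiser may be moved to index
0. -/
theorem exists_rationalSubspace_near {n d : ℕ} (x : Fin n → ℝ) {A B C : ℝ} (hB : 0 < B)
    {v : Fin (d + 1) → EuclideanSpace ℝ (Fin (n + 1))} {r : Fin (d + 1) → ℝ}
    (hv : ∀ i, v i ∈ integerLattice (n + 1)) (hli : LinearIndependent ℝ v)
    (hr : ∀ i, 0 < r i) (hC : ∏ i, r i ≤ C)
    (hlast : ∀ i, |v i (Fin.last n)| ≤ r i * A)
    (hnear : ∀ i, ‖v i - v i (Fin.last n) • homogenize x‖ ≤ r i * B)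
    (hsmall : (‖homogenize x‖ + 1) ^ (d + 1) * C * B ^ (d + 1) < 1) :
    ∃ L : AffineSubspace ℝ (Fin n → ℝ), IsRationalSubspace d L ∧ 0 < height L ∧
      height L ≤ (‖homogenize x‖ + 1) * 2 ^ d * C * (A * B ^ d) ∧
      Metric.infDist x (L : Set (Fin n → ℝ)) * height L ≤
        (‖homogenize x‖ + 1) * 2 ^ d * C * B ^ (d + 1) := by
  obtain ⟨k, hk⟩ := Finite.exists_max fun i => |v i (Fin.last n)| / r i
  let σ := Equiv.swap 0 k
  refine exists_rationalSubspace_near_of_max x hB (v := v ∘ σ) (r := r ∘ σ) (fun i => hv _)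
    (hli.comp σ σ.injective) (fun i => hr _) ?_ (fun i => hlast _) (fun i => hnear _)
    (fun i => ?_) hsmall
  · rwa [← Equiv.prod_comp σ] at hC
  · have : σ 0 = k := Equiv.swap_apply_left _ _
    simp only [Function.comp_apply, this]
    exact hk _

/-- A coordinate subspace through the origin, whose cone has an orthonormal family of integer
vectors; it serves for small `N`. -/
theorem exists_rationalSubspace_height_le_one {n d : ℕ} (hd : d < n) :
    ∃ L : AffineSubspace ℝ (Fin n → ℝ), IsRationalSubspace d L ∧ (0 : Fin n → ℝ) ∈ L ∧
      0 < height L ∧ height L ≤ 1 := by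
  let f : Fin (d + 1) → Fin (n + 1) :=
    Fin.cons (Fin.last n) fun j => (Fin.castLE hd.le j).castSucc
  have hf : Function.Injective f := by
    rw [Fin.cons_injective_iff]
    refine ⟨?_, (Fin.castSucc_injective n).comp (Fin.castLE_injective hd.le)⟩
    rintro ⟨j, hj⟩
    exact (Fin.castSucc_lt_last _).ne hj
  let b := EuclideanSpace.basisFun (Fin (n + 1)) ℝ
  have hlast : ∀ j : Fin d, b (f j.succ) (Fin.last n) = 0 := fun j => by
    have hne : f j.succ ≠ Fin.last n := (Fin.castSucc_lt_last _).ne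
    simp [b, hne.symm]
  obtain ⟨L, hL, h0, hpos, hle⟩ := exists_rationalSubspace (v := b ∘ f)
    (fun i => Submodule.subset_span ⟨f i, rfl⟩)
    (b.orthonormal.linearIndependent.comp f hf) (by simp [b, f])
  refine ⟨L, hL, ?_, hpos, hle.trans (le_of_eq ?_)⟩
  · convert! h0 using 1
    ext j
    simp [b, f, (Fin.castSucc_lt_last _).ne]
  · simp [hlast, b.orthonormal.1]

/-! ### Choice of parameters and of the constant -/

theorem exists_approximation_constant {n d : ℕ} (hd : d < n) (x : Fin n → ℝ) :
    ∃ c : ℝ, 0 < c ∧ ∀ N : ℕ, 1 ≤ N →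
      ∃ L : AffineSubspace ℝ (Fin n → ℝ), IsRationalSubspace d L ∧
        Metric.infDist x (L : Set (Fin n → ℝ)) ≤
          c * (height L)⁻¹ * (N : ℝ) ^ (-omega n d) ∧ height L ≤ N := by
  obtain ⟨C, hC, happ⟩ := exists_linearIndependent_near hd x
  set X := ‖homogenize x‖
  have hX : 0 ≤ X := norm_nonneg _
  set w := omega n d
  have hw : 0 < w := omega_pos hd
  have hnd : (0 : ℝ) < n - d := sub_pos.2 (by exact_mod_cast hd)
  set K := (X + 1) * 2 ^ d * C
  have hK : 0 < K := by positivity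
  obtain ⟨N₀, hN₀⟩ : ∃ N₀ : ℝ, ∀ N ≥ N₀, (X + 1) ^ (d + 1) * C * (N / K) ^ (-w) < 1 := by
    have h1 : Filter.Tendsto (fun N : ℝ => (X + 1) ^ (d + 1) * C * (N / K) ^ (-w))
        Filter.atTop (nhds ((X + 1) ^ (d + 1) * C * 0)) :=
      ((tendsto_rpow_neg_atTop hw).comp
        (Filter.tendsto_id.atTop_div_const hK)).const_mul _
    rw [mul_zero] at h1
    exact Filter.eventually_atTop.1 (h1.eventually (gt_mem_nhds one_pos))
  have hN₁ : 0 < max N₀ 1 := lt_max_of_lt_right one_pos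
  -- The first summand serves `N ≥ N₀`, where distance times height is at most `K * (N / K) ^ (-w)`;
  -- the second serves `N < N₀`.
  refine ⟨K * K ^ w + ‖x‖ * max N₀ 1 ^ w, by positivity, fun N hN => ?_⟩
  have hNpos : (0 : ℝ) < N := by exact_mod_cast hN
  rcases le_or_gt N₀ N with hlarge | hsmall
  · set T : ℝ := N / K
    have hT : 0 < T := div_pos hNpos hK
    -- These exponents solve `A * B ^ n = 1` and `A * B ^ d = T`; then `B ^ (d + 1) = T ^ (-w)`, and
    -- the height bound becomes `K * T = N`.
    let A : ℝ := T ^ ((n : ℝ) / (n - d))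
    let B : ℝ := T ^ (-(1 / ((n : ℝ) - d)))
    have hA : 0 < A := Real.rpow_pos_of_pos hT _
    have hB : 0 < B := Real.rpow_pos_of_pos hT _
    have hBpow : ∀ k : ℕ, B ^ k = T ^ (-(k / ((n : ℝ) - d))) := fun k => by
      rw [← Real.rpow_natCast, ← Real.rpow_mul hT.le]
      congr 1
      ring
    have hAB : A * B ^ n = 1 := by
      rw [hBpow, ← Real.rpow_add hT, add_neg_cancel, Real.rpow_zero]
    have hABd : A * B ^ d = T := by
      rw [hBpow, ← Real.rpow_add hT, ← sub_eq_add_neg, ← sub_div, div_self hnd.ne',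
        Real.rpow_one]
    have hBd : B ^ (d + 1) = T ^ (-w) := by
      rw [hBpow]
      simp [w, omega]
    obtain ⟨v, r, hv, hli, hr, hrC, hlast, hnear⟩ := happ A B hA hB hAB
    obtain ⟨L, hL, hpos, hH, hdist⟩ := exists_rationalSubspace_near x hB hv hli hr hrC hlast hnear
      (by rw [hBd]; exact hN₀ N hlarge)
    refine ⟨L, hL, ?_, ?_⟩
    · rw [hBd, Real.div_rpow hNpos.le hK.le, Real.rpow_neg hK.le, div_inv_eq_mul,
        ← le_div_iff₀ hpos] at hdist
      refine hdist.trans ?_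
      have h1 : 0 ≤ ‖x‖ * max N₀ 1 ^ w * (height L)⁻¹ * (N : ℝ) ^ (-w) := by positivity
      have h2 : K * ((N : ℝ) ^ (-w) * K ^ w) / height L =
          K * K ^ w * (height L)⁻¹ * (N : ℝ) ^ (-w) := by
        rw [div_eq_mul_inv]; ring
      rw [h2]
      linarith
    · rw [hABd] at hH
      exact hH.trans_eq (mul_div_cancel₀ _ hK.ne')
  · obtain ⟨L, hL, h0, hpos, hle⟩ := exists_rationalSubspace_height_le_one hd
    refine ⟨L, hL, ?_, hle.trans (by exact_mod_cast hN)⟩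
    have h1 : Metric.infDist x (L : Set (Fin n → ℝ)) ≤ ‖x‖ := by
      simpa using Metric.infDist_le_dist_of_mem (x := x) h0
    have h2 : max N₀ 1 ^ (-w) ≤ (N : ℝ) ^ (-w) :=
      Real.rpow_le_rpow_of_nonpos hNpos (hsmall.le.trans (le_max_left _ _)) (by linarith)
    have h3 : 1 ≤ (height L)⁻¹ := (one_le_inv₀ hpos).2 hle
    calc _ ≤ ‖x‖ := h1
      _ = ‖x‖ * max N₀ 1 ^ w * 1 * max N₀ 1 ^ (-w) := by
          rw [Real.rpow_neg hN₁.le, mul_one, mul_inv_cancel_right₀ (by positivity)]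
      _ ≤ (K * K ^ w + ‖x‖ * max N₀ 1 ^ w) * (height L)⁻¹ * (N : ℝ) ^ (-w) := by
          gcongr
          exact le_add_of_nonneg_left (by positivity)

end RationalApprox
end

open RationalApprox in
theorem propositionA7 (n : ℕ) (x : Fin n → ℝ) :
    (∀ d < n, ExteriorDirichlet d x) ∧
    ((∀ d < n, ExteriorDirichlet d x) →
      ∃ c : ℝ, 0 < c ∧ ∀ d < n, ∀ N : ℕ, 1 ≤ N →
        ∃ L : AffineSubspace ℝ (Fin n → ℝ), IsRationalSubspace d L ∧
          Metric.infDist x (L : Set (Fin n → ℝ)) ≤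
            c * (height L)⁻¹ * (N : ℝ) ^ (-omega n d) ∧
          height L ≤ N) := by
  refine ⟨fun d hd => exteriorDirichlet hd x, fun _ => ?_⟩
  have h : ∀ d : Fin n, ∃ c : ℝ, 0 < c ∧ ∀ N : ℕ, 1 ≤ N →
      ∃ L : AffineSubspace ℝ (Fin n → ℝ), IsRationalSubspace d L ∧
        Metric.infDist x (L : Set (Fin n → ℝ)) ≤
          c * (height L)⁻¹ * (N : ℝ) ^ (-omega n d) ∧ height L ≤ N :=
    fun d => exists_approximation_constant d.2 x
  choose c hc happ using h
  have hsum : 0 ≤ ∑ d, c d := Finset.sum_nonneg fun d _ => (hc d).le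
  -- The sum dominates every `c d`; the added 1 keeps the constant positive when `n = 0`.
  refine ⟨1 + ∑ d, c d, by linarith, fun d hd N hN => ?_⟩
  obtain ⟨L, hL, hdist, hH⟩ := happ ⟨d, hd⟩ N hN
  refine ⟨L, hL, hdist.trans ?_, hH⟩
  have hle : c ⟨d, hd⟩ ≤ ∑ d, c d :=
    Finset.single_le_sum (fun d _ => (hc d).le) (Finset.mem_univ _)
  have hnonneg : 0 ≤ height L := ENNReal.toReal_nonneg
  gcongr
  linarith
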